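/- Let $(\mathbb P,\sigma)$ be a connected smooth Riemannian manifold of dimension $m$, let $I\subseteq\mathbb R$ be an open interval, and let $h\in C^\infty(\mathbb P)$, $\rho\in C^\infty(I)$ be positive functions. Let $\overline M=I\times\mathbb P$ be the doubly warped product spacetime with the Lorentzian metric $$\overline g_{(t,x)}=-h(x)^2\,\pi_I^*(dt^2)+\rho(t)^2\,\pi_{\mathbb P}^*(\sigma),$$ where $\pi_I,\pi_{\mathbb P}$ are the projections of $I\times\mathbb P$ onto its factors. A spacelike hypersurface of $\overline M$ is a (Hausdorff, nonempty) smooth $m$-dimensional manifold $M$ with a smooth map $\psi:M\to\overline M$ such that $g=\psi^*\overline g$ is a Riemannian metric on $M$; it is called complete if $M$ is complete for the Riemannian distance of $g$. Then: 1. If $\overline M$ admits a compact spacelike hypersurface, then $\mathbb P$ is compact. 2. If the universal covering of $\mathbb P$ is compact, then every connected complete spacelike hypersurface $\psi:M\to\overline M$ for which the function $\rho\circ\pi_I\circ\psi$ is bounded on $M$ is compact. -/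

import Mathlib

open scoped Manifold ContDiff ENNReal Topology

noncomputable section

/-- The data of a doubly warped product spacetime `I ₕ×ᵨ P`: an open interval `I ⊆ ℝ`, a smooth
Riemannian metric `σ` on the smooth `m`-manifold `P`, and smooth positive functions
`h` on `P` and `ρ` on `I`. -/
structure DoublyWarpedProduct (m : ℕ) (P : Type*) [TopologicalSpace P]
    [ChartedSpace (EuclideanSpace ℝ (Fin m)) P] [IsManifold (𝓡 m) ∞ P] where
  /-- The open interval. -/
  I : TopologicalSpace.Opens ℝ
  interval : (I : Set ℝ).OrdConnected
  /-- The Riemannian metric of `P`. -/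
  σ : Bundle.ContMDiffRiemannianMetric (𝓡 m) ∞ (EuclideanSpace ℝ (Fin m))
    (fun x : P => TangentSpace (𝓡 m) x)
  /-- The warping function on `P`. -/
  h : P → ℝ
  h_smooth : ContMDiff (𝓡 m) 𝓘(ℝ, ℝ) ∞ h
  h_pos : ∀ x, 0 < h x
  /-- The warping function on `I`. -/
  ρ : I → ℝ
  ρ_smooth : ContMDiff 𝓘(ℝ, ℝ) 𝓘(ℝ, ℝ) ∞ ρ
  ρ_pos : ∀ t, 0 < ρ t

namespace DoublyWarpedProduct

variable {m : ℕ} {P : Type*} [TopologicalSpace P]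
  [ChartedSpace (EuclideanSpace ℝ (Fin m)) P] [IsManifold (𝓡 m) ∞ P]

/-- The underlying product manifold `I × P` of the spacetime. -/
abbrev Carrier (S : DoublyWarpedProduct m P) : Type _ := S.I × P

/-- The one-form `π_I^* dt` on `I × P`: the differential of the coordinate function
`(t, x) ↦ t`. -/
def dt (S : DoublyWarpedProduct m P) (p : S.Carrier)
    (v : TangentSpace (𝓘(ℝ, ℝ).prod (𝓡 m)) p) : ℝ :=
  mfderiv (𝓘(ℝ, ℝ).prod (𝓡 m)) 𝓘(ℝ, ℝ) (fun q : S.Carrier => (q.1 : ℝ)) p v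

/-- The differential of the projection `π_P : I × P → P`. -/
def dπP (S : DoublyWarpedProduct m P) (p : S.Carrier)
    (v : TangentSpace (𝓘(ℝ, ℝ).prod (𝓡 m)) p) : TangentSpace (𝓡 m) p.2 :=
  mfderiv (𝓘(ℝ, ℝ).prod (𝓡 m)) (𝓡 m) (fun q : S.Carrier => q.2) p v

/-- The Lorentzian metric `- h² π_I^*(dt²) + ρ² π_P^* σ` of the doubly warped product. -/
def metric (S : DoublyWarpedProduct m P) (p : S.Carrier)
    (v w : TangentSpace (𝓘(ℝ, ℝ).prod (𝓡 m)) p) : ℝ :=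
  -(S.h p.2) ^ 2 * (S.dt p v * S.dt p w)
    + (S.ρ p.1) ^ 2 * S.σ.inner p.2 (S.dπP p v) (S.dπP p w)

variable {M : Type*} [TopologicalSpace M] [ChartedSpace (EuclideanSpace ℝ (Fin m)) M]

/-- The symmetric bilinear form `g = ψ^* (metric)` on `M` induced by `ψ : M → I × P`. -/
def inducedMetric (S : DoublyWarpedProduct m P) (ψ : M → S.Carrier) (x : M)
    (v w : TangentSpace (𝓡 m) x) : ℝ :=
  S.metric (ψ x) (mfderiv (𝓡 m) (𝓘(ℝ, ℝ).prod (𝓡 m)) ψ x v)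
    (mfderiv (𝓡 m) (𝓘(ℝ, ℝ).prod (𝓡 m)) ψ x w)

/-- `ψ : M → I × P`, with `M` of dimension `m`, is a spacelike (immersed) hypersurface: it is
smooth and the induced form `g` is a Riemannian metric, i.e. positive definite at each point
(smoothness and symmetry of `g` are automatic, and so is injectivity of the differential). -/
structure IsSpacelikeHypersurface (S : DoublyWarpedProduct m P) (ψ : M → S.Carrier) : Prop where
  smooth : ContMDiff (𝓡 m) (𝓘(ℝ, ℝ).prod (𝓡 m)) ∞ ψ
  posDef : ∀ (x : M) (v : TangentSpace (𝓡 m) x), v ≠ 0 → 0 < S.inducedMetric ψ x v v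

/-- The distance of the induced metric `g`: the infimum of the `g`-lengths `∫ √(g(γ', γ'))` of
`C^1` paths `γ` from `x` to `y`. -/
def inducedEDist (S : DoublyWarpedProduct m P) (ψ : M → S.Carrier) (x y : M) : ℝ≥0∞ :=
  letI : ∀ z : M, ENorm (TangentSpace (𝓡 m) z) :=
    fun z => ⟨fun v => ENNReal.ofReal (Real.sqrt (S.inducedMetric ψ z v v))⟩
  Manifold.riemannianEDist (𝓡 m) x y

/-- The spacelike hypersurface `ψ` is complete: every sequence that is Cauchy for the distance of
the induced metric converges in `M`. -/
def IsCompleteHypersurface (S : DoublyWarpedProduct m P) (ψ : M → S.Carrier) : Prop :=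
  ∀ u : ℕ → M,
    (∀ ε : ℝ≥0∞, 0 < ε → ∃ N : ℕ, ∀ i ≥ N, ∀ j ≥ N, S.inducedEDist ψ (u i) (u j) < ε) →
    ∃ x : M, Filter.Tendsto u Filter.atTop (𝓝 x)

end DoublyWarpedProduct

/-- `p : Y → X` is a universal covering of the connected space `X`: a covering map with simply
connected total space. -/
structure IsUniversalCovering {Y X : Type*} [TopologicalSpace Y] [TopologicalSpace X]
    (p : Y → X) : Prop where
  isCoveringMap : IsCoveringMap p
  simplyConnected : SimplyConnectedSpace Y

end

open Set Filter

/-! The map f = π_P ∘ ψ carries the proof. The time term of the metric is nonpositive, so g ≤ ρ²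
f^*σ; positive definiteness of g then makes df injective and, since dim M = dim P, f is a local
homeomorphism. In part 1 the image of f is compact and open, hence all of the connected space P
(`compactSpace_of_isLocalHomeomorph`).

In part 2, let ρ ≤ R along ψ. Partial lifts of a C^1 path of speed ≤ K in P have g-speed ≤ R K, so
completeness makes them cluster at the end of their interval, and they extend
(`IsSpacelikeHypersurface.exists_isLiftOn`). Lifting segments in a chart yields local sections of f
(`exists_sections_of_lift_contMDiff`), and these let every continuous path lift
(`exists_isLiftOn_of_sections`). By monodromy the universal covering Q → P factors through a local
homeomorphism F : Q → M, whose image is compact and open, so it is M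
(`compactSpace_of_path_lifting`). -/

/-- `Γ` is a continuous lift of `γ` through `f` on `s`. -/
structure IsLiftOn {M P : Type*} [TopologicalSpace M] (f : M → P) (γ : ℝ → P)
    (s : Set ℝ) (Γ : ℝ → M) : Prop where
  continuousOn : ContinuousOn Γ s
  lift : ∀ t ∈ s, f (Γ t) = γ t

theorem IsLiftOn.mono {M P : Type*} [TopologicalSpace M] {f : M → P} {γ : ℝ → P}
    {s s' : Set ℝ} {Γ : ℝ → M} (h : IsLiftOn f γ s Γ) (hs : s' ⊆ s) : IsLiftOn f γ s' Γ :=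
  ⟨h.continuousOn.mono hs, fun t ht => h.lift t (hs ht)⟩

/-! ### Path lifting and compactness for local homeomorphisms. -/

section Lifting

variable {M P : Type*} [TopologicalSpace M] [TopologicalSpace P] {f : M → P} {γ : ℝ → P}

theorem IsLiftOn.eqOn [T2Space M] (hf : IsLocalHomeomorph f) {s : Set ℝ} (hs : IsPreconnected s)
    {Γ Γ' : ℝ → M} (h : IsLiftOn f γ s Γ) (h' : IsLiftOn f γ s Γ') {a : ℝ} (ha : a ∈ s)
    (haa : Γ a = Γ' a) : EqOn Γ Γ' s :=
  (T2Space.isSeparatedMap f).eqOn_of_comp_eqOn hf.isLocallyInjective hs h.continuousOn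
    h'.continuousOn (fun t ht => by simp [h.lift t ht, h'.lift t ht]) ha haa

omit [TopologicalSpace P] in
/-- Lifts on `[0, a]` and `[a, b]` that agree at `a` glue to a lift on `[0, b]`. -/
theorem IsLiftOn.extend {a b : ℝ} {Γ Δ : ℝ → M} (ha : 0 ≤ a) (hab : a ≤ b)
    (h : IsLiftOn f γ (Icc 0 a) Γ) (h' : IsLiftOn f γ (Icc a b) Δ) (haa : Γ a = Δ a) :
    ∃ Γ' : ℝ → M, IsLiftOn f γ (Icc 0 b) Γ' ∧ Γ' 0 = Γ 0 := by
  classical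
  have e1 : EqOn (fun t => if t ≤ a then Γ t else Δ t) Γ (Icc 0 a) := fun t ht => by simp [ht.2]
  have e2 : EqOn (fun t => if t ≤ a then Γ t else Δ t) Δ (Icc a b) := fun t ht => by
    rcases ht.1.eq_or_lt with rfl | h1
    · simp [haa]
    · simp [h1]
  refine ⟨fun t => if t ≤ a then Γ t else Δ t, ⟨?_, fun t ht => ?_⟩, by simp [ha]⟩
  · rw [← Icc_union_Icc_eq_Icc ha hab]
    exact (h.continuousOn.congr e1).union_of_isClosed (h'.continuousOn.congr e2)
      isClosed_Icc isClosed_Icc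
  · rcases le_total t a with h1 | h1
    · exact (congrArg f (e1 ⟨ht.1, h1⟩)).trans (h.lift t ⟨ht.1, h1⟩)
    · exact (congrArg f (e2 ⟨h1, ht.2⟩)).trans (h'.lift t ⟨h1, ht.2⟩)

/-- A path that lifts on `[0, b)` and whose lift clusters at `b` lifts past `b`. -/
theorem IsLiftOn.extend_of_cluster (hf : IsLocalHomeomorph f) [T2Space P]
    (hγ : ContinuousOn γ (Icc 0 1)) {b : ℝ} (hb : b ∈ Ioc (0 : ℝ) 1) {Γ : ℝ → M}
    (h : IsLiftOn f γ (Ico 0 b) Γ) {z : M} (hz : MapClusterPt z (𝓝[<] b) Γ) :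
    ∃ δ > 0, ∃ Γ' : ℝ → M, IsLiftOn f γ (Icc 0 (min (b + δ) 1)) Γ' ∧ Γ' 0 = Γ 0 := by
  have hfz : f z = γ b := by
    have h1 : MapClusterPt (f z) (𝓝[<] b) (f ∘ Γ) := hz.continuousAt_comp hf.continuous.continuousAt
    have h2 : Tendsto γ (𝓝[<] b) (𝓝 (γ b)) := by
      refine (hγ b ⟨hb.1.le, hb.2⟩).mono_left ?_
      rw [← nhdsWithin_Ioo_eq_nhdsLT hb.1]
      exact nhdsWithin_mono _ fun t ht => ⟨ht.1.le, ht.2.le.trans hb.2⟩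
    have h3 : Tendsto (f ∘ Γ) (𝓝[<] b) (𝓝 (γ b)) := by
      refine h2.congr' ?_
      filter_upwards [Ioo_mem_nhdsLT hb.1] with t ht using (h.lift t ⟨ht.1.le, ht.2⟩).symm
    exact eq_of_nhds_neBot (ClusterPt.mono h1 h3)
  obtain ⟨e, hze, rfl⟩ := hf z
  have hbt : γ b ∈ e.target := hfz ▸ e.map_source hze
  have hev : ∀ᶠ t in 𝓝[Icc 0 1] b, γ t ∈ e.target :=
    hγ b ⟨hb.1.le, hb.2⟩ (e.open_target.mem_nhds hbt)
  obtain ⟨δ, hδ, hδt⟩ := Metric.mem_nhdsWithin_iff.1 hev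
  have hfr : ∃ᶠ t in 𝓝[<] b, Γ t ∈ e.source := hz.frequently (e.open_source.mem_nhds hze)
  have hev2 : ∀ᶠ t in 𝓝[<] b, t ∈ Ioo (max 0 (b - δ)) b :=
    Ioo_mem_nhdsLT (max_lt hb.1 (by linarith))
  -- Clustering only gives frequent visits of `Γ` to `e.source`. One such time `a` close to `b`
  -- suffices: from `a` on, `Γ` is replaced by `e.symm ∘ γ`.
  obtain ⟨a, has, ha1, ha2⟩ := (hfr.and_eventually hev2).exists
  rw [max_lt_iff] at ha1
  have hmaps : MapsTo γ (Icc a (min (b + δ / 2) 1)) e.target := fun t ht => by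
    refine hδt ⟨?_, ha1.1.le.trans ht.1, ht.2.trans (min_le_right _ _)⟩
    rw [Metric.mem_ball, Real.dist_eq, abs_lt]
    have := ht.2.trans (min_le_left _ _)
    constructor <;> linarith [ht.1]
  have hsub : Icc a (min (b + δ / 2) 1) ⊆ Icc 0 1 :=
    Icc_subset_Icc ha1.1.le (min_le_right _ _)
  obtain ⟨Γ', h1, h2⟩ := IsLiftOn.extend (f := e) (γ := γ) (Γ := Γ) (Δ := e.symm ∘ γ)
    (b := min (b + δ / 2) 1) ha1.1.le (le_min (by linarith) (by linarith [hb.2]))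
    (h.mono fun t ht => ⟨ht.1, ht.2.trans_lt ha2⟩)
    ⟨e.continuousOn_symm.comp (hγ.mono hsub) hmaps, fun t ht => e.right_inv (hmaps ht)⟩
    (by simp [← h.lift a ⟨ha1.1.le, ha2⟩, e.left_inv has])
  exact ⟨δ / 2, half_pos hδ, Γ', h1, h2⟩

/-- A path lifts to a local homeomorphism as soon as every partial lift has a cluster point. -/
theorem exists_isLiftOn_of_forall_cluster [T2Space M] [T2Space P] (hf : IsLocalHomeomorph f)
    (hγ : ContinuousOn γ (Icc 0 1)) {y : M} (hy : f y = γ 0)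
    (H : ∀ b ∈ Ioc (0 : ℝ) 1, ∀ Γ : ℝ → M, Γ 0 = y → IsLiftOn f γ (Ico 0 b) Γ →
      ∃ z, MapClusterPt z (𝓝[<] b) Γ) :
    ∃ Γ : ℝ → M, Γ 0 = y ∧ IsLiftOn f γ (Icc 0 1) Γ := by
  let A : Set ℝ := {b | b ∈ Icc (0 : ℝ) 1 ∧ ∃ Γ : ℝ → M, Γ 0 = y ∧ IsLiftOn f γ (Icc 0 b) Γ}
  have h0A : (0 : ℝ) ∈ A := ⟨by simp, fun _ => y, rfl, continuousOn_const, fun t ht => by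
    rw [Icc_self, mem_singleton_iff] at ht; rw [ht, hy]⟩
  have hbdd : BddAbove A := ⟨1, fun b hb => hb.1.2⟩
  have hdown : ∀ a ∈ A, ∀ b, 0 ≤ b → b ≤ a → b ∈ A := fun a ⟨ha, Γ, h1, h2⟩ b hb hba =>
    ⟨⟨hb, hba.trans ha.2⟩, Γ, h1, h2.mono (Icc_subset_Icc_right hba)⟩
  -- A first lift through a local inverse at `y` makes the supremum of `A` positive, as `H`
  -- requires.
  obtain ⟨a₀, ha₀, ha₀A⟩ : ∃ a > 0, a ∈ A := by
    obtain ⟨e, hze, rfl⟩ := hf y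
    have hev : ∀ᶠ t in 𝓝[Icc 0 1] (0 : ℝ), γ t ∈ e.target :=
      hγ 0 (by simp) (e.open_target.mem_nhds (hy ▸ e.map_source hze))
    obtain ⟨δ, hδ, hδt⟩ := Metric.mem_nhdsWithin_iff.1 hev
    have hmaps : MapsTo γ (Icc 0 (min (δ / 2) 1)) e.target := fun t ht => by
      refine hδt ⟨?_, ht.1, ht.2.trans (min_le_right _ _)⟩
      rw [Metric.mem_ball, Real.dist_eq, abs_lt]
      have := ht.2.trans (min_le_left _ _)
      constructor <;> linarith [ht.1]
    refine ⟨min (δ / 2) 1, by positivity, ⟨by positivity, min_le_right _ _⟩, e.symm ∘ γ, ?_, ?_, ?_⟩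
    · simp [← hy, e.left_inv hze]
    · exact e.continuousOn_symm.comp
        (hγ.mono (Icc_subset_Icc_right (min_le_right _ _))) hmaps
    · exact fun t ht => e.right_inv (hmaps ht)
  set b := sSup A with hbdef
  have hb0 : 0 < b := ha₀.trans_le (le_csSup hbdd ha₀A)
  have hb1 : b ≤ 1 := csSup_le ⟨0, h0A⟩ fun a ha => ha.1.2
  have hlt : ∀ t, 0 ≤ t → t < b → t ∈ A := fun t ht htb => by
    obtain ⟨a, ha, hta⟩ := exists_lt_of_lt_csSup ⟨0, h0A⟩ htb
    exact hdown a ha t ht hta.le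
  have hA : ∀ t, ∃ Γ : ℝ → M, t ∈ A → Γ 0 = y ∧ IsLiftOn f γ (Icc 0 t) Γ := fun t => by
    by_cases ht : t ∈ A
    · obtain ⟨Γ, h⟩ := ht.2
      exact ⟨Γ, fun _ => h⟩
    · exact ⟨fun _ => y, fun h => absurd h ht⟩
  choose G hGA using hA
  have hG0 : ∀ t ∈ A, G t 0 = y := fun t ht => (hGA t ht).1
  have hG : ∀ t ∈ A, IsLiftOn f γ (Icc 0 t) (G t) := fun t ht => (hGA t ht).2
  have hagree : ∀ s t, 0 ≤ s → s ≤ t → t < b → G s s = G t s := fun s t hs hst htb => by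
    have hsA := hlt s hs (hst.trans_lt htb)
    have htA := hlt t (hs.trans hst) htb
    exact (hG s hsA).eqOn hf isPreconnected_Icc ((hG t htA).mono (Icc_subset_Icc_right hst))
      (a := 0) ⟨le_rfl, hs⟩ (by rw [hG0 s hsA, hG0 t htA]) ⟨hs, le_rfl⟩
  -- The diagonal `t ↦ G t t` merges the chosen lifts: by uniqueness it coincides with `G c` on `[0,
  -- c]` for each `c < b`.
  have hΓ : IsLiftOn f γ (Ico 0 b) fun t => G t t := by
    refine ⟨fun t ht => ?_, fun t ht => (hG t (hlt t ht.1 ht.2)).lift t ⟨ht.1, le_rfl⟩⟩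
    obtain ⟨c, htc, hcb⟩ := exists_between ht.2
    have hcA := hlt c (ht.1.trans htc.le) hcb
    have h1 : ContinuousWithinAt (G c) (Ico 0 b) t :=
      ((hG c hcA).continuousOn t ⟨ht.1, htc.le⟩).mono_of_mem_nhdsWithin
        (mem_nhdsWithin.2 ⟨Iio c, isOpen_Iio, htc, fun s hs => ⟨hs.2.1, hs.1.le⟩⟩)
    refine h1.congr_of_eventuallyEq ?_ (hagree t c ht.1 htc.le hcb)
    filter_upwards [self_mem_nhdsWithin, mem_nhdsWithin_of_mem_nhds (Iio_mem_nhds htc)] with s hs hs'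
    exact hagree s c hs.1 hs'.le hcb
  obtain ⟨z, hz⟩ := H b ⟨hb0, hb1⟩ (fun t => G t t) (hG0 0 h0A) hΓ
  obtain ⟨δ, hδ, Γ', h1, h2⟩ := hΓ.extend_of_cluster hf hγ ⟨hb0, hb1⟩ hz
  -- The lift reaches `min (b + δ) 1`, which cannot exceed the supremum `b`; hence this minimum is
  -- 1.
  have hmem : min (b + δ) 1 ∈ A :=
    ⟨⟨by positivity, min_le_right _ _⟩, Γ', by rw [h2]; exact hG0 0 h0A, h1⟩
  have hle := le_csSup hbdd hmem
  have h11 : min (b + δ) 1 = 1 := by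
    rcases min_choice (b + δ) 1 with h | h
    · rw [h] at hle; linarith
    · exact h
  rw [h11] at h1
  exact ⟨Γ', by rw [h2]; exact hG0 0 h0A, h1⟩

/-- A local homeomorphism over a base covered by open sets carrying sections through all points
of their preimages has the path lifting property. -/
theorem exists_isLiftOn_of_sections [T2Space M] [T2Space P] (hf : IsLocalHomeomorph f)
    (hsec : ∀ x : P, ∃ U ∈ 𝓝 x, ∀ y, f y ∈ U → ∃ s : P → M, ContinuousOn s U ∧ s (f y) = y ∧
      ∀ u ∈ U, f (s u) = u)
    (hγ : ContinuousOn γ (Icc 0 1)) {y : M} (hy : f y = γ 0) :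
    ∃ Γ : ℝ → M, Γ 0 = y ∧ IsLiftOn f γ (Icc 0 1) Γ := by
  refine exists_isLiftOn_of_forall_cluster hf hγ hy fun b hb Γ hΓ0 hΓ => ?_
  obtain ⟨U, hU, hs⟩ := hsec (γ b)
  obtain ⟨δ, hδ, hδt⟩ := Metric.mem_nhdsWithin_iff.1 (hγ b ⟨hb.1.le, hb.2⟩ hU)
  obtain ⟨a, ha1, hab⟩ := exists_between (max_lt hb.1 (by linarith : b - δ < b))
  rw [max_lt_iff] at ha1
  have hmaps : MapsTo γ (Icc a b) U := fun t ht => by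
    refine hδt ⟨?_, ha1.1.le.trans ht.1, ht.2.trans hb.2⟩
    rw [Metric.mem_ball, Real.dist_eq, abs_lt]
    constructor <;> linarith [ht.1, ht.2]
  have hΓa := hΓ.lift a ⟨ha1.1.le, hab⟩
  obtain ⟨s, hsc, hsy, hsu⟩ := hs (Γ a) (hΓa ▸ hmaps ⟨le_rfl, hab.le⟩)
  have hsγ : ContinuousOn (s ∘ γ) (Icc a b) :=
    hsc.comp (hγ.mono (Icc_subset_Icc ha1.1.le hb.2)) hmaps
  -- Near `b` the lift is a section applied to `γ`, so it converges to `s (γ b)`.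
  have heq : EqOn Γ (s ∘ γ) (Ico a b) :=
    (hΓ.mono (Ico_subset_Ico_left ha1.1.le)).eqOn hf isPreconnected_Ico
      ⟨hsγ.mono Ico_subset_Icc_self, fun t ht => hsu _ (hmaps (Ico_subset_Icc_self ht))⟩
      (a := a) ⟨le_rfl, hab⟩ (by simp [← hΓa, hsy])
  refine ⟨s (γ b), Tendsto.mapClusterPt ?_⟩
  have h1 : Tendsto (s ∘ γ) (𝓝[<] b) (𝓝 (s (γ b))) := by
    rw [← nhdsWithin_Ioo_eq_nhdsLT hab]
    exact (hsγ b ⟨hab.le, le_rfl⟩).mono_left (nhdsWithin_mono _ Ioo_subset_Icc_self)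
  refine h1.congr' ?_
  filter_upwards [Ioo_mem_nhdsLT hab] with t ht using (heq ⟨ht.1.le, ht.2⟩).symm

/-- A connected Hausdorff space that maps to `P` by a local homeomorphism with the path lifting
property is compact if some compact simply connected space is locally homeomorphic to `P`. -/
theorem compactSpace_of_path_lifting [T2Space M] [ConnectedSpace M] [PathConnectedSpace P]
    [LocallyPathConnectedSpace P] (hf : IsLocalHomeomorph f)
    (hlift : ∀ (γ : C(unitInterval, P)) (y : M), f y = γ 0 →
      ∃ Γ : C(unitInterval, M), Γ 0 = y ∧ f ∘ Γ = γ)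
    {Q : Type*} [TopologicalSpace Q] [CompactSpace Q] [SimplyConnectedSpace Q] {p : Q → P}
    (hp : IsLocalHomeomorph p) : CompactSpace M := by
  have hloc : LocallyPathConnectedSpace Q := by
    -- The local inverses of `p` serve as charts with values in `P`, so `Q` inherits local path
    -- connectedness.
    let _ : ChartedSpace P Q :=
      { atlas := range fun q => (hp q).choose
        chartAt := fun q => (hp q).choose
        mem_chart_source := fun q => (hp q).choose_spec.1
        chart_mem_atlas := fun q => mem_range_self q }
    exact ChartedSpace.locallyPathConnectedSpace P Q
  obtain ⟨q₀⟩ : Nonempty Q := inferInstance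
  obtain ⟨m₀⟩ : Nonempty M := inferInstance
  obtain ⟨m₁, hm₁⟩ : ∃ m₁, f m₁ = p q₀ := by
    let γ := PathConnectedSpace.somePath (f m₀) (p q₀)
    obtain ⟨Γ, -, h⟩ := hlift γ m₀ (by simp)
    exact ⟨Γ 1, by simpa using congrFun h 1⟩
  have hsep : IsSeparatedMap f := T2Space.isSeparatedMap f
  -- Lifting `p` through `f` requires that lifts of paths with the same ends in `Q` have the same
  -- end in `M`. Simple connectedness gives a homotopy `K` between the paths, and monodromy along `p
  -- ∘ K` gives the equality.
  obtain ⟨F, ⟨hF0, hF⟩, -⟩ := hf.existsUnique_continuousMap_lifts ⟨p, hp.continuous⟩ q₀ m₁ hm₁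
    (fun γ hγ => hlift (ContinuousMap.comp ⟨p, hp.continuous⟩ γ) m₁ (by simp [hγ, hm₁]))
    (by
      intro γ γ' Γ Γ' h0 h0' hΓ0 hΓ0' hΓ hΓ' h1
      let c : Path q₀ (γ 1) := ⟨γ, h0, rfl⟩
      let c' : Path q₀ (γ 1) := ⟨γ', h0', h1.symm⟩
      obtain ⟨K⟩ : Path.Homotopic c c' := SimplyConnectedSpace.paths_homotopic c c'
      let Kp := K.compContinuousMap (⟨p, hp.continuous⟩ : C(Q, P))
      have hK0 : ∀ t, Kp (t, 0) = f m₁ := fun t => by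
        have : K (t, 0) = q₀ := K.source t
        rw [hm₁]; exact congrArg p this
      choose L hL0 hL using fun t => hlift (Kp.curry t) m₁ (by simp [hK0])
      have hmon := hf.monodromy_theorem hsep Kp L (fun t s => congrFun (hL t) s)
        (fun t => by rw [hL0, hL0]) 1
      have e0 : Γ = L 0 := by
        refine DFunLike.coe_injective (hsep.eq_of_comp_eq hf.isLocallyInjective Γ.continuous
          (L 0).continuous ?_ 0 (by rw [hΓ0, hL0]))
        rw [hΓ, hL]
        ext t
        simp [c, Kp]
      have e1 : Γ' = L 1 := by
        refine DFunLike.coe_injective (hsep.eq_of_comp_eq hf.isLocallyInjective Γ'.continuous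
          (L 1).continuous ?_ 0 (by rw [hΓ0', hL0]))
        rw [hΓ', hL]
        ext t
        simp [c', Kp]
      rw [e0, e1, hmon])
  have hFl : IsLocalHomeomorph F := IsLocalHomeomorph.of_comp (g := f) (by rw [hF]; exact hp) hf F.continuous
  have hclopen : IsClopen (range F) :=
    ⟨(isCompact_range F.continuous).isClosed, hFl.isOpenMap.isOpen_range⟩
  have huniv : range F = univ := hclopen.eq_univ (range_nonempty F)
  exact ⟨huniv ▸ isCompact_range F.continuous⟩

/-- A nonempty compact space can only be mapped by a local homeomorphism to a connected Hausdorff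
space if the latter is compact. -/
theorem compactSpace_of_isLocalHomeomorph [Nonempty M] [CompactSpace M] [T2Space P]
    [ConnectedSpace P] (hf : IsLocalHomeomorph f) : CompactSpace P := by
  have hclopen : IsClopen (range f) :=
    ⟨(isCompact_range hf.continuous).isClosed, hf.isOpenMap.isOpen_range⟩
  exact ⟨hclopen.eq_univ (range_nonempty f) ▸ isCompact_range hf.continuous⟩

end Lifting

/-! ### The inverse function theorem and the regularity of lifts. -/

section InverseFunction

variable {E : Type*} [NormedAddCommGroup E] [NormedSpace ℝ E] [FiniteDimensional ℝ E]
  {M : Type*} [TopologicalSpace M] [ChartedSpace E M] [IsManifold 𝓘(ℝ, E) 1 M]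
  {P : Type*} [TopologicalSpace P] [ChartedSpace E P] [IsManifold 𝓘(ℝ, E) 1 P]

/-- The inverse function theorem between manifolds of the same dimension. -/
theorem exists_openPartialHomeomorph_of_injective_mfderiv {f : M → P}
    (hc : Continuous f) {x : M} (hf : ContMDiffAt 𝓘(ℝ, E) 𝓘(ℝ, E) 1 f x)
    (hinj : Function.Injective (mfderiv 𝓘(ℝ, E) 𝓘(ℝ, E) f x)) :
    ∃ e : OpenPartialHomeomorph M P, x ∈ e.source ∧ EqOn f e e.source ∧
      ContMDiffAt 𝓘(ℝ, E) 𝓘(ℝ, E) 1 e.symm (f x) := by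
  have : CompleteSpace E := FiniteDimensional.complete ℝ E
  set φ := chartAt E x with hφ
  set χ := chartAt E (f x) with hχ
  set F : E → E := writtenInExtChartAt 𝓘(ℝ, E) 𝓘(ℝ, E) x f with hFdef
  have hF : ContDiffAt ℝ 1 F (φ x) := by
    have := (contMDiffAt_iff.1 hf).2
    simpa [hFdef, writtenInExtChartAt, contDiffWithinAt_univ] using this
  have hd : mfderiv 𝓘(ℝ, E) 𝓘(ℝ, E) f x = fderiv ℝ F (φ x) := by
    rw [(hf.mdifferentiableAt one_ne_zero).mfderiv]
    simp [hFdef, hφ]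
    rfl
  have hinj' : Function.Injective (fderiv ℝ F (φ x)) := by rw [← hd]; exact hinj
  let L : E ≃L[ℝ] E :=
    (LinearEquiv.ofInjectiveEndo (fderiv ℝ F (φ x)).toLinearMap hinj').toContinuousLinearEquiv
  have hL : HasFDerivAt F (L : E →L[ℝ] E) (φ x) := by
    have h1 : (L : E →L[ℝ] E) = fderiv ℝ F (φ x) := by ext v; rfl
    rw [h1]
    exact (hF.differentiableAt one_ne_zero).hasFDerivAt
  let G := hF.toOpenPartialHomeomorph F hL one_ne_zero
  have hG : (G : E → E) = F := hF.toOpenPartialHomeomorph_coe hL one_ne_zero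
  have hxG : φ x ∈ G.source := hF.mem_toOpenPartialHomeomorph_source hL one_ne_zero
  have hFx : F (φ x) = χ (f x) := by
    simp [hFdef, writtenInExtChartAt, hφ, hχ]
  -- Off this preimage, F ∘ φ need not represent `f`, as `χ` is a chart only on its source.
  let φ' := φ.restrOpen (f ⁻¹' χ.source) (χ.open_source.preimage hc)
  let e := (φ'.trans G).trans χ.symm
  have hxe : x ∈ e.source := by
    have h1 : x ∈ φ.source := mem_chart_source E x
    have h2 : f x ∈ χ.source := mem_chart_source E (f x)
    have h3 : χ (f x) ∈ χ.target := χ.map_source h2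
    simp [e, φ', hG, hFx, hxG, h1, h2, h3]
  have heq : EqOn f e e.source := by
    intro z hz
    have hz' : z ∈ φ.source ∧ f z ∈ χ.source := by
      simp [e, φ'] at hz
      tauto
    have : e z = χ.symm (F (φ z)) := by simp [e, φ', hG]
    rw [this]
    simp [hFdef, writtenInExtChartAt, ← hφ, ← hχ, φ.left_inv hz'.1, χ.left_inv hz'.2]
  refine ⟨e, hxe, heq, ?_⟩
  have h1 : ContMDiffAt 𝓘(ℝ, E) 𝓘(ℝ, E) 1 χ (f x) := contMDiffAt_of_mem_maximalAtlas
    (IsManifold.chart_mem_maximalAtlas _) (mem_chart_source E _)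
  have h2 : ContMDiffAt 𝓘(ℝ, E) 𝓘(ℝ, E) 1 G.symm (χ (f x)) := by
    rw [← hFx]
    exact (hF.to_localInverse hL one_ne_zero).contMDiffAt
  have hGx : G.symm (χ (f x)) = φ x := by rw [← hFx, ← hG, G.left_inv hxG]
  have h3 : ContMDiffAt 𝓘(ℝ, E) 𝓘(ℝ, E) 1 φ.symm (φ x) :=
    contMDiffAt_symm_of_mem_maximalAtlas
      (IsManifold.chart_mem_maximalAtlas _) (mem_chart_target E _)
  have h4 := ContMDiffAt.comp (f x) (g := G.symm) h2 h1
  exact ContMDiffAt.comp (f x) (g := φ.symm) (f := G.symm ∘ χ) (by simpa [hGx] using h3) h4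

theorem isLocalHomeomorph_of_injective_mfderiv {f : M → P}
    (hf : ContMDiff 𝓘(ℝ, E) 𝓘(ℝ, E) 1 f)
    (hinj : ∀ x, Function.Injective (mfderiv 𝓘(ℝ, E) 𝓘(ℝ, E) f x)) : IsLocalHomeomorph f :=
  IsLocalHomeomorph.mk f fun x =>
    let ⟨e, h1, h2, _⟩ := exists_openPartialHomeomorph_of_injective_mfderiv hf.continuous (hf x)
      (hinj x)
    ⟨e, h1, h2⟩

/-- Lifts of `C^1` paths through a local diffeomorphism are `C^1`. -/
theorem IsLiftOn.contMDiffAt {f : M → P}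
    (hf : ContMDiff 𝓘(ℝ, E) 𝓘(ℝ, E) 1 f)
    (hinj : ∀ x, Function.Injective (mfderiv 𝓘(ℝ, E) 𝓘(ℝ, E) f x))
    {γ : ℝ → P} {Γ : ℝ → M} {s : Set ℝ} (h : IsLiftOn f γ s Γ) {t : ℝ} (ht : s ∈ 𝓝 t)
    (hγ : ContMDiffAt 𝓘(ℝ, ℝ) 𝓘(ℝ, E) 1 γ t) : ContMDiffAt 𝓘(ℝ, ℝ) 𝓘(ℝ, E) 1 Γ t := by
  obtain ⟨e, he, heq, hes⟩ :=
    exists_openPartialHomeomorph_of_injective_mfderiv hf.continuous (hf (Γ t)) (hinj (Γ t))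
  have hft : f (Γ t) = γ t := h.lift t (mem_of_mem_nhds ht)
  have h1 : ContMDiffAt 𝓘(ℝ, ℝ) 𝓘(ℝ, E) 1 (e.symm ∘ γ) t :=
    ContMDiffAt.comp t (by rwa [← hft]) hγ
  refine h1.congr_of_eventuallyEq ?_
  filter_upwards [ht, (h.continuousOn.continuousAt ht) (e.open_source.mem_nhds he)] with u hu hu'
  simp [← h.lift u hu, heq hu', e.left_inv hu']

end InverseFunction

/-! ### Completeness and paths of bounded speed. -/

section Speed

variable {E : Type*} [NormedAddCommGroup E] [NormedSpace ℝ E]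
  {M : Type*} [TopologicalSpace M] [ChartedSpace E M]

/-- In a complete manifold, a `C^1` path of bounded speed on a bounded interval clusters at the
end of the interval. -/
theorem exists_mapClusterPt_of_bounded_speed
    [∀ z : M, ENorm (TangentSpace 𝓘(ℝ, E) z)]
    [∀ z : M, ENormSMulClass ℝ (TangentSpace 𝓘(ℝ, E) z)]
    (hcomplete : ∀ u : ℕ → M,
      (∀ ε : ℝ≥0∞, 0 < ε → ∃ N : ℕ, ∀ i ≥ N, ∀ j ≥ N,
        Manifold.riemannianEDist 𝓘(ℝ, E) (u i) (u j) < ε) → ∃ x : M, Tendsto u atTop (𝓝 x))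
    {b : ℝ} (hb : 0 < b) {Γ : ℝ → M} {K : NNReal}
    (hΓ : ∀ t ∈ Ioo 0 b, ContMDiffAt 𝓘(ℝ, ℝ) 𝓘(ℝ, E) 1 Γ t)
    (hK : ∀ t ∈ Ioo 0 b, ‖mfderiv 𝓘(ℝ, ℝ) 𝓘(ℝ, E) Γ t 1‖ₑ ≤ K) :
    ∃ z, MapClusterPt z (𝓝[<] b) Γ := by
  have hle : ∀ s t, 0 < s → s ≤ t → t < b →
      Manifold.riemannianEDist 𝓘(ℝ, E) (Γ s) (Γ t) ≤ K * ENNReal.ofReal (t - s) := by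
    intro s t hs hst htb
    have hsub : Icc s t ⊆ Ioo 0 b := fun u hu => ⟨hs.trans_le hu.1, hu.2.trans_lt htb⟩
    refine (Manifold.riemannianEDist_le_pathELength (γ := Γ) (a := s) (b := t)
      (fun u hu => (hΓ u (hsub hu)).contMDiffWithinAt) rfl rfl hst).trans ?_
    rw [Manifold.pathELength_eq_lintegral_mfderiv_Icc]
    calc _ ≤ ∫⁻ _ in Icc s t, (K : ℝ≥0∞) :=
          MeasureTheory.setLIntegral_mono' measurableSet_Icc fun u hu => hK u (hsub hu)
      _ = _ := by simp
  have hle' : ∀ s ∈ Ioo 0 b, ∀ t ∈ Ioo 0 b,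
      Manifold.riemannianEDist 𝓘(ℝ, E) (Γ s) (Γ t) ≤ ENNReal.ofReal (K * dist s t) := by
    intro s hs t ht
    rw [ENNReal.ofReal_mul NNReal.zero_le_coe, ENNReal.ofReal_coe_nnreal]
    rcases le_total s t with h | h
    · rw [dist_comm, Real.dist_eq, abs_of_nonneg (sub_nonneg.2 h)]
      exact hle s t hs.1 h ht.2
    · rw [Real.dist_eq, abs_of_nonneg (sub_nonneg.2 h), Manifold.riemannianEDist_comm]
      exact hle t s ht.1 h hs.2
  obtain ⟨v, -, hvmem, hvlim⟩ := exists_seq_strictMono_tendsto' hb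
  have hv : Tendsto v atTop (𝓝[<] b) :=
    tendsto_nhdsWithin_iff.2 ⟨hvlim, Eventually.of_forall fun n => (hvmem n).2⟩
  obtain ⟨z, hz⟩ := hcomplete (Γ ∘ v) fun ε hε => by
    obtain ⟨r, hr, hrε⟩ : ∃ r : ℝ, 0 < r ∧ ENNReal.ofReal r < ε := by
      obtain ⟨r, hr, hrε⟩ := ENNReal.lt_iff_exists_nnreal_btwn.1 hε
      exact ⟨r, by exact_mod_cast hr, by simpa using hrε⟩
    -- The denominator `K + 1` covers the case `K = 0`.
    obtain ⟨N, hN⟩ := Metric.cauchySeq_iff.1 hvlim.cauchySeq (r / (K + 1)) (by positivity)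
    refine ⟨N, fun i hi j hj => ((hle' _ (hvmem i) _ (hvmem j)).trans ?_).trans_lt hrε⟩
    apply ENNReal.ofReal_le_ofReal
    have h1 := (hN i hi j hj).le
    calc K * dist (v i) (v j) ≤ (K + 1) * (r / (K + 1)) := by gcongr; simp
      _ = r := by field_simp
  exact ⟨z, MapClusterPt.of_comp hv hz.mapClusterPt⟩

end Speed

/-! ### Local sections from lifted segments. -/

section Sections

variable {E : Type*} [NormedAddCommGroup E] [NormedSpace ℝ E]
  {M : Type*} [TopologicalSpace M] [T2Space M]
  {P : Type*} [TopologicalSpace P] [ChartedSpace E P] [IsManifold 𝓘(ℝ, E) 1 P]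

/-- If `C^1` paths lift through a local homeomorphism to a manifold, then it has local
sections over neighbourhoods that do not depend on the point of the fibre. -/
theorem exists_sections_of_lift_contMDiff {f : M → P} (hf : IsLocalHomeomorph f)
    {N : ∀ z : P, TangentSpace 𝓘(ℝ, E) z → ℝ≥0∞}
    (hN : ∀ x : P, ∃ C : NNReal, ∀ᶠ c in 𝓝 (extChartAt 𝓘(ℝ, E) x x), ∀ w : E,
      N _ (mfderiv 𝓘(ℝ, E) 𝓘(ℝ, E) (extChartAt 𝓘(ℝ, E) x).symm c w) ≤ C * ‖w‖ₑ)
    (hlift : ∀ (γ : ℝ → P) (K : NNReal),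
      (∀ t ∈ Icc (0 : ℝ) 1, ContMDiffAt 𝓘(ℝ, ℝ) 𝓘(ℝ, E) 1 γ t) →
      (∀ t ∈ Icc (0 : ℝ) 1, N _ (mfderiv 𝓘(ℝ, ℝ) 𝓘(ℝ, E) γ t 1) ≤ K) →
      ∀ y, f y = γ 0 → ∃ Γ : ℝ → M, Γ 0 = y ∧ IsLiftOn f γ (Icc 0 1) Γ) (x : P) :
    ∃ U ∈ 𝓝 x, ∀ y, f y ∈ U → ∃ s : P → M, ContinuousOn s U ∧ s (f y) = y ∧
      ∀ u ∈ U, f (s u) = u := by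
  classical
  obtain ⟨C, hC⟩ := hN x
  set φ := extChartAt 𝓘(ℝ, E) x with hφ
  have htar : φ.target ∈ 𝓝 (φ x) := extChartAt_target_mem_nhds x
  obtain ⟨r, hr, hrB⟩ := Metric.mem_nhds_iff.1 (inter_mem htar hC)
  set B := Metric.ball (φ x) r with hB
  have hBt : B ⊆ φ.target := fun c hc => (hrB hc).1
  have hsm : ∀ c ∈ B, ContMDiffAt 𝓘(ℝ, E) 𝓘(ℝ, E) 1 φ.symm c := fun c hc =>
    ((contMDiffOn_extChartAt_symm x) c (hBt hc)).contMDiffAt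
      (mem_of_superset (Metric.isOpen_ball.mem_nhds hc) hBt)
  set U := φ.source ∩ φ ⁻¹' B with hU
  have hUx : U ∈ 𝓝 x := inter_mem (extChartAt_source_mem_nhds x)
    (continuousAt_extChartAt x (Metric.ball_mem_nhds _ hr))
  refine ⟨U, hUx, fun y hy => ?_⟩
  set a := φ (f y) with ha
  have haB : a ∈ B := hy.2
  have hmem : ∀ c ∈ B, ∀ t ∈ Icc (0 : ℝ) 1, AffineMap.lineMap a c t ∈ B := fun c hc t ht =>
    (convex_ball (φ x) r).lineMap_mem haB hc ht
  -- The section sends `u` to the endpoint of the lift, from `y`, of the chart segment from `a` to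
  -- `φ u`. Convexity keeps segments in `B`, and `B` was fixed before `y`.
  let γ : E → ℝ → P := fun c t => φ.symm (AffineMap.lineMap a c t)
  have hγ0 : ∀ c, f y = γ c 0 := fun c => by simp [γ, ha, φ.left_inv hy.1]
  have hline : ∀ c t, ContMDiffAt 𝓘(ℝ, ℝ) 𝓘(ℝ, E) 1 (fun t : ℝ => AffineMap.lineMap a c t) t :=
    fun c t => (ContinuousAffineMap.lineMap (R := ℝ) a c).contDiff.contDiffAt.contMDiffAt
  have hex : ∀ c ∈ B, ∃ Γ : ℝ → M, Γ 0 = y ∧ IsLiftOn f (γ c) (Icc 0 1) Γ := by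
    intro c hc
    refine hlift (γ c) (C * ‖c - a‖₊) (fun t ht => ?_) (fun t ht => ?_) y (hγ0 c)
    · exact ContMDiffAt.comp t (hsm _ (hmem c hc t ht)) (hline c t)
    · have h1 : mfderiv 𝓘(ℝ, ℝ) 𝓘(ℝ, E) (γ c) t =
          (mfderiv 𝓘(ℝ, E) 𝓘(ℝ, E) φ.symm (AffineMap.lineMap a c t)).comp
            (mfderiv 𝓘(ℝ, ℝ) 𝓘(ℝ, E) (fun t : ℝ => AffineMap.lineMap a c t) t) :=
        mfderiv_comp t ((hsm _ (hmem c hc t ht)).mdifferentiableAt one_ne_zero)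
          ((hline c t).mdifferentiableAt one_ne_zero)
      have h2 : mfderiv 𝓘(ℝ, ℝ) 𝓘(ℝ, E) (fun t : ℝ => AffineMap.lineMap a c t) t (1 : ℝ)
          = (c - a : E) := by
        have h : fderiv ℝ (fun t : ℝ => AffineMap.lineMap a c t) t 1 = c - a := by
          rw [fderiv_apply_one_eq_deriv]
          exact (AffineMap.hasDerivAt_lineMap).deriv
        rw [mfderiv_eq_fderiv]
        exact h
      have h3 : mfderiv 𝓘(ℝ, ℝ) 𝓘(ℝ, E) (γ c) t (1 : ℝ) =
          mfderiv 𝓘(ℝ, E) 𝓘(ℝ, E) φ.symm (AffineMap.lineMap a c t) (c - a : E) :=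
        (DFunLike.congr_fun h1 (1 : ℝ)).trans (congrArg _ h2)
      refine (congrArg (N (γ c t)) h3).trans_le ?_
      exact (hrB (hmem c hc t ht)).2 (c - a)
  choose G hG0 hG using fun c : B => hex c c.2
  have hcont : Continuous fun q : unitInterval × B => γ q.2 q.1 := by
    have hl : Continuous fun q : unitInterval × B => AffineMap.lineMap a (q.2 : E) (q.1 : ℝ) := by
      simp only [AffineMap.lineMap_apply_module]
      fun_prop
    exact (continuousOn_extChartAt_symm x).comp_continuous hl
      fun q => hBt (hmem _ q.2.2 _ q.1.2)
  -- Each lift is continuous in time and all start at `y`; over a local homeomorphism with separated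
  -- fibres this forces joint continuity in time and endpoint.
  have hg := hf.continuous_lift (T2Space.isSeparatedMap f) ⟨_, hcont⟩
    (g := fun q : unitInterval × B => G q.2 q.1)
    (by ext q; exact (hG q.2).lift _ q.1.2)
    (by simpa [hG0] using continuous_const)
    (fun c => (hG c).continuousOn.comp_continuous continuous_subtype_val fun t => t.2)
  refine ⟨fun u => if h : φ u ∈ B then G ⟨φ u, h⟩ 1 else y, ?_, ?_, fun u hu => ?_⟩
  · rw [continuousOn_iff_continuous_domRestrict]
    have h1 : Continuous fun u : U => (⟨φ u, u.2.2⟩ : B) :=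
      ((continuousOn_extChartAt x).comp_continuous continuous_subtype_val
        fun u : U => u.2.1).subtype_mk _
    have h2 := hg.comp ((continuous_const (y := (1 : unitInterval))).prodMk h1)
    refine h2.congr fun u => ?_
    have hu : φ (u : P) ∈ B := u.2.2
    simp [hu]
  · have h1 : IsLiftOn f (γ a) (Icc 0 1) fun _ => y :=
      ⟨continuousOn_const, fun t _ => by simp [γ, ha, φ.left_inv hy.1]⟩
    have h2 := (hG ⟨a, haB⟩).eqOn hf isPreconnected_Icc h1 (a := 0) (by simp) (hG0 _)
    simp only [← ha, haB, dif_pos]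
    exact h2 (by simp)
  · have h1 := (hG ⟨φ u, hu.2⟩).lift 1 (by simp)
    have hu2 : φ u ∈ B := hu.2
    simp only [hu2, dif_pos, h1]
    simp [γ, φ.left_inv hu.1]

end Sections

/-! ### Chart bounds for a Riemannian metric. -/

section Chart

open Bundle
variable {E : Type*} [NormedAddCommGroup E] [NormedSpace ℝ E]
  {P : Type*} [TopologicalSpace P] [ChartedSpace E P] [IsManifold 𝓘(ℝ, E) 1 P]
  [RiemannianBundle (fun x : P => TangentSpace 𝓘(ℝ, E) x)]
  [IsContinuousRiemannianBundle E (fun x : P => TangentSpace 𝓘(ℝ, E) x)]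

attribute [local instance] normedAddCommGroupTangentSpaceVectorSpace
attribute [local instance] normedSpaceTangentSpaceVectorSpace

/-- The inverse of a chart of a Riemannian manifold has locally bounded derivative. -/
theorem exists_eventually_enorm_mfderiv_extChartAt_symm_le (x : P) :
    ∃ C : NNReal, ∀ᶠ c in 𝓝 (extChartAt 𝓘(ℝ, E) x x), ∀ w : E,
      ‖mfderiv 𝓘(ℝ, E) 𝓘(ℝ, E) (extChartAt 𝓘(ℝ, E) x).symm c w‖ₑ ≤ C * ‖w‖ₑ := by
  obtain ⟨C, -, hC⟩ := eventually_enorm_mfderivWithin_symm_extChartAt_lt 𝓘(ℝ, E) x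
  simp only [modelWithCornersSelf_coe, range_id, nhdsWithin_univ, mfderivWithin_univ] at hC
  refine ⟨C, ?_⟩
  filter_upwards [hC] with c hc w
  refine (ContinuousLinearMap.le_opENorm
    (mfderiv 𝓘(ℝ, E) 𝓘(ℝ, E) (extChartAt 𝓘(ℝ, E) x).symm c) w).trans ?_
  gcongr
  · exact hc.le
  · exact le_rfl

end Chart

/-! ### The projection of a spacelike hypersurface to P. -/

namespace DoublyWarpedProduct

open Bundle

variable {m : ℕ} {P : Type*} [TopologicalSpace P]
  [ChartedSpace (EuclideanSpace ℝ (Fin m)) P] [IsManifold (𝓡 m) ∞ P]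

/-- The inverse of a chart of `P` has locally bounded derivative for the metric `σ`. -/
theorem exists_eventually_σ_mfderiv_extChartAt_symm_le (S : DoublyWarpedProduct m P) (x : P) :
    ∃ C : NNReal, ∀ᶠ c in 𝓝 (extChartAt (𝓡 m) x x), ∀ w : EuclideanSpace ℝ (Fin m),
      ENNReal.ofReal (√(S.σ.inner _ (mfderiv (𝓡 m) (𝓡 m) (extChartAt (𝓡 m) x).symm c w)
        (mfderiv (𝓡 m) (𝓡 m) (extChartAt (𝓡 m) x).symm c w))) ≤ C * ‖w‖ₑ := by
  let _ : RiemannianBundle (fun x : P => TangentSpace (𝓡 m) x) := ⟨S.σ.toRiemannianMetric⟩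
  have : IsManifold (𝓡 m) 1 P := IsManifold.of_le (n := ∞) (by simp)
  have : IsContinuousRiemannianBundle (EuclideanSpace ℝ (Fin m))
      (fun x : P => TangentSpace (𝓡 m) x) :=
    ⟨S.σ.inner, S.σ.contMDiff.continuous, fun _ _ _ => rfl⟩
  have h := exists_eventually_enorm_mfderiv_extChartAt_symm_le (E := EuclideanSpace ℝ (Fin m)) x
  have key : ∀ (z : P) (v : TangentSpace (𝓡 m) z),
      ‖v‖ₑ = ENNReal.ofReal (√(S.σ.inner z v v)) := by
    intro z v
    rw [← ofReal_norm, @norm_eq_sqrt_real_inner]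
    rfl
  simpa only [key] using h

variable {M : Type*} [TopologicalSpace M] [ChartedSpace (EuclideanSpace ℝ (Fin m)) M]
  {S : DoublyWarpedProduct m P} {ψ : M → S.Carrier}

theorem IsSpacelikeHypersurface.contMDiff_snd (hψ : S.IsSpacelikeHypersurface ψ) :
    ContMDiff (𝓡 m) (𝓡 m) 1 fun x => (ψ x).2 :=
  (ContMDiff.comp (g := Prod.snd) _root_.contMDiff_snd hψ.smooth).of_le (by simp)

theorem IsSpacelikeHypersurface.mfderiv_snd (hψ : S.IsSpacelikeHypersurface ψ) (x : M)
    (v : TangentSpace (𝓡 m) x) :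
    mfderiv (𝓡 m) (𝓡 m) (fun x => (ψ x).2) x v =
      S.dπP (ψ x) (mfderiv (𝓡 m) (𝓘(ℝ, ℝ).prod (𝓡 m)) ψ x v) := by
  have h := mfderiv_comp (I := 𝓡 m) (I' := 𝓘(ℝ, ℝ).prod (𝓡 m)) (I'' := 𝓡 m) x
    (g := fun q : S.Carrier => q.2) (f := ψ) mdifferentiableAt_snd
    ((hψ.smooth x).mdifferentiableAt (by simp))
  exact DFunLike.congr_fun h v

/-- The discarded term -h² dt(dψ v)² is nonpositive. This one comparison gives both the injectivity
of the differential of the projection and the speed bound for lifts. -/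
theorem IsSpacelikeHypersurface.inducedMetric_le (hψ : S.IsSpacelikeHypersurface ψ) (x : M)
    (v : TangentSpace (𝓡 m) x) :
    S.inducedMetric ψ x v v ≤ (S.ρ (ψ x).1) ^ 2 *
      S.σ.inner (ψ x).2 (mfderiv (𝓡 m) (𝓡 m) (fun x => (ψ x).2) x v)
        (mfderiv (𝓡 m) (𝓡 m) (fun x => (ψ x).2) x v) := by
  rw [hψ.mfderiv_snd, inducedMetric, metric]
  nlinarith [mul_nonneg (sq_nonneg (S.h (ψ x).2))
    (mul_self_nonneg (S.dt (ψ x) (mfderiv (𝓡 m) (𝓘(ℝ, ℝ).prod (𝓡 m)) ψ x v)))]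

theorem IsSpacelikeHypersurface.injective_mfderiv_snd (hψ : S.IsSpacelikeHypersurface ψ) (x : M) :
    Function.Injective (mfderiv (𝓡 m) (𝓡 m) (fun x => (ψ x).2) x) := by
  rw [injective_iff_map_eq_zero]
  intro v hv
  by_contra hne
  have h1 := hψ.posDef x v hne
  have h2 := hψ.inducedMetric_le x v
  rw [hv] at h2
  simp only [map_zero, mul_zero] at h2
  exact absurd h1 h2.not_gt

theorem IsSpacelikeHypersurface.isLocalHomeomorph_snd [IsManifold (𝓡 m) ∞ M]
    (hψ : S.IsSpacelikeHypersurface ψ) : IsLocalHomeomorph fun x => (ψ x).2 :=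
  have : IsManifold (𝓡 m) 1 P := IsManifold.of_le (n := ∞) (by simp)
  have : IsManifold (𝓡 m) 1 M := IsManifold.of_le (n := ∞) (by simp)
  isLocalHomeomorph_of_injective_mfderiv hψ.contMDiff_snd hψ.injective_mfderiv_snd

theorem inducedMetric_smul (S : DoublyWarpedProduct m P) (ψ : M → S.Carrier) (x : M) (c : ℝ)
    (v : TangentSpace (𝓡 m) x) :
    S.inducedMetric ψ x (c • v) (c • v) = c ^ 2 * S.inducedMetric ψ x v v := by
  have hdt : ∀ p w, S.dt p (c • w) = c * S.dt p w := fun p w => map_smul _ c w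
  have hdP : ∀ p w, S.dπP p (c • w) = c • S.dπP p w := fun p w => map_smul _ c w
  simp only [inducedMetric, metric, map_smul, hdt, hdP, smul_apply, smul_eq_mul]
  ring

/-- The norm of tangent vectors for the induced metric. -/
@[reducible] noncomputable def inducedENorm (S : DoublyWarpedProduct m P) (ψ : M → S.Carrier) (z : M) :
    ENorm (TangentSpace (𝓡 m) z) :=
  ⟨fun v => ENNReal.ofReal (Real.sqrt (S.inducedMetric ψ z v v))⟩

theorem enormSMulClass_inducedENorm (S : DoublyWarpedProduct m P) (ψ : M → S.Carrier) (z : M) :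
    letI := S.inducedENorm ψ z
    ENormSMulClass ℝ (TangentSpace (𝓡 m) z) := by
  let _ := S.inducedENorm ψ z
  refine ⟨fun c v => ?_⟩
  change ENNReal.ofReal (√(S.inducedMetric ψ z (c • v) (c • v))) =
    ‖c‖ₑ * ENNReal.ofReal (√(S.inducedMetric ψ z v v))
  rw [S.inducedMetric_smul, Real.sqrt_mul (sq_nonneg c), Real.sqrt_sq_eq_abs,
    ENNReal.ofReal_mul (abs_nonneg c), ← Real.norm_eq_abs, ofReal_norm]

/-- Over a complete spacelike hypersurface along which `ρ` is bounded, paths of bounded speed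
in `P` lift through the projection. -/
theorem IsSpacelikeHypersurface.exists_isLiftOn [IsManifold (𝓡 m) ∞ M] [T2Space M] [T2Space P]
    (hψ : S.IsSpacelikeHypersurface ψ) (hcomplete : S.IsCompleteHypersurface ψ) {R : NNReal}
    (hR : ∀ x, S.ρ (ψ x).1 ≤ R) {γ : ℝ → P} {K : NNReal}
    (hγ : ∀ t ∈ Icc (0 : ℝ) 1, ContMDiffAt 𝓘(ℝ, ℝ) (𝓡 m) 1 γ t)
    (hK : ∀ t ∈ Icc (0 : ℝ) 1, ENNReal.ofReal (√(S.σ.inner (γ t)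
      (mfderiv 𝓘(ℝ, ℝ) (𝓡 m) γ t (1 : ℝ)) (mfderiv 𝓘(ℝ, ℝ) (𝓡 m) γ t (1 : ℝ)))) ≤ K)
    {y : M} (hy : (ψ y).2 = γ 0) :
    ∃ Γ : ℝ → M, Γ 0 = y ∧ IsLiftOn (fun x => (ψ x).2) γ (Icc 0 1) Γ := by
  have : IsManifold (𝓡 m) 1 P := IsManifold.of_le (n := ∞) (by simp)
  have : IsManifold (𝓡 m) 1 M := IsManifold.of_le (n := ∞) (by simp)
  refine exists_isLiftOn_of_forall_cluster hψ.isLocalHomeomorph_snd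
    (fun t ht => (hγ t ht).continuousAt.continuousWithinAt) hy fun b hb Γ hΓ0 hΓ => ?_
  have hsub : ∀ t ∈ Ioo 0 b, t ∈ Icc (0 : ℝ) 1 := fun t ht => ⟨ht.1.le, ht.2.le.trans hb.2⟩
  have hnhds : ∀ t ∈ Ioo 0 b, Ico 0 b ∈ 𝓝 t := fun t ht => Ico_mem_nhds ht.1 ht.2
  have hsm : ∀ t ∈ Ioo 0 b, ContMDiffAt 𝓘(ℝ, ℝ) (𝓡 m) 1 Γ t := fun t ht =>
    hΓ.contMDiffAt hψ.contMDiff_snd hψ.injective_mfderiv_snd (hnhds t ht) (hγ t (hsub t ht))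
  let _ := S.inducedENorm ψ
  have := S.enormSMulClass_inducedENorm ψ
  refine exists_mapClusterPt_of_bounded_speed (K := R * K) hcomplete hb.1 hsm fun t ht => ?_
  have hev : (fun x => (ψ x).2) ∘ Γ =ᶠ[𝓝 t] γ := by
    filter_upwards [hnhds t ht] with u hu using hΓ.lift u hu
  have h1 := mfderiv_comp t (I := 𝓘(ℝ, ℝ)) (I' := 𝓡 m) (I'' := 𝓡 m)
    (g := fun x => (ψ x).2) (f := Γ)
    ((hψ.contMDiff_snd (Γ t)).mdifferentiableAt one_ne_zero)
    ((hsm t ht).mdifferentiableAt one_ne_zero)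
  set w := mfderiv 𝓘(ℝ, ℝ) (𝓡 m) Γ t (1 : ℝ) with hw
  have h2 : mfderiv 𝓘(ℝ, ℝ) (𝓡 m) ((fun x => (ψ x).2) ∘ Γ) t (1 : ℝ) =
      mfderiv (𝓡 m) (𝓡 m) (fun x => (ψ x).2) (Γ t) w := DFunLike.congr_fun h1 (1 : ℝ)
  have h3 : ENNReal.ofReal (√(S.σ.inner (ψ (Γ t)).2
      (mfderiv (𝓡 m) (𝓡 m) (fun x => (ψ x).2) (Γ t) w)
      (mfderiv (𝓡 m) (𝓡 m) (fun x => (ψ x).2) (Γ t) w))) ≤ K := by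
    -- The two tangent vectors have base points that are equal only propositionally. Viewing all
    -- tangent spaces as the model space lets the norm be rewritten in both arguments.
    let N : P → EuclideanSpace ℝ (Fin m) → ℝ≥0∞ := fun z v =>
      ENNReal.ofReal (√(S.σ.inner z (v : TangentSpace (𝓡 m) z) (v : TangentSpace (𝓡 m) z)))
    have h4 : mfderiv 𝓘(ℝ, ℝ) (𝓡 m) γ t (1 : ℝ) =
        mfderiv (𝓡 m) (𝓡 m) (fun x => (ψ x).2) (Γ t) w :=
      (DFunLike.congr_fun hev.mfderiv_eq (1 : ℝ)).symm.trans h2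
    exact (congrArg₂ N hev.eq_of_nhds h4.symm).trans_le (hK t (hsub t ht))
  change ENNReal.ofReal (√(S.inducedMetric ψ (Γ t) w w)) ≤ _
  rw [ENNReal.coe_mul]
  calc _ ≤ ENNReal.ofReal (R * √(S.σ.inner (ψ (Γ t)).2
      (mfderiv (𝓡 m) (𝓡 m) (fun x => (ψ x).2) (Γ t) w)
      (mfderiv (𝓡 m) (𝓡 m) (fun x => (ψ x).2) (Γ t) w))) := by
        refine ENNReal.ofReal_le_ofReal ((Real.sqrt_le_sqrt (hψ.inducedMetric_le _ w)).trans ?_)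
        rw [Real.sqrt_mul (sq_nonneg _), Real.sqrt_sq (S.ρ_pos _).le]
        exact mul_le_mul_of_nonneg_right (hR _) (Real.sqrt_nonneg _)
    _ ≤ R * K := by
        rw [ENNReal.ofReal_mul NNReal.zero_le_coe, ENNReal.ofReal_coe_nnreal]
        exact mul_le_mul' le_rfl h3

theorem IsSpacelikeHypersurface.compactSpace_of_complete [IsManifold (𝓡 m) ∞ M] [T2Space M]
    [ConnectedSpace M] [T2Space P] [ConnectedSpace P]
    (hψ : S.IsSpacelikeHypersurface ψ) (hcomplete : S.IsCompleteHypersurface ψ)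
    (hbdd : Bornology.IsBounded (Set.range fun x : M => S.ρ (ψ x).1))
    {Q : Type*} [TopologicalSpace Q] [CompactSpace Q] {p : Q → P} (hp : IsUniversalCovering p) :
    CompactSpace M := by
  have : IsManifold (𝓡 m) 1 P := IsManifold.of_le (n := ∞) (by simp)
  obtain ⟨R, hR⟩ := hbdd.bddAbove
  have hR' : ∀ x, S.ρ (ψ x).1 ≤ R.toNNReal := fun x =>
    (hR (mem_range_self x)).trans (Real.le_coe_toNNReal R)
  have hloc := hψ.isLocalHomeomorph_snd
  have : LocallyPathConnectedSpace P :=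
    ChartedSpace.locallyPathConnectedSpace (EuclideanSpace ℝ (Fin m)) P
  have : PathConnectedSpace P := PathConnectedSpace.of_locallyPathConnectedSpace
  have : SimplyConnectedSpace Q := hp.simplyConnected
  refine compactSpace_of_path_lifting hloc (fun γ y hy => ?_) hp.isCoveringMap.isLocalHomeomorph
  -- The path is extended to ℝ by its end values, as the lifting lemmas take paths defined on ℝ.
  have hγ : Continuous (γ ∘ projIcc (0 : ℝ) 1 zero_le_one) := γ.continuous.comp continuous_projIcc
  obtain ⟨Γ, hΓ0, hΓ⟩ := exists_isLiftOn_of_sections hloc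
    (exists_sections_of_lift_contMDiff hloc
      (N := fun z v => ENNReal.ofReal (√(S.σ.inner z v v)))
      S.exists_eventually_σ_mfderiv_extChartAt_symm_le
      fun γ K h1 h2 y hy => hψ.exists_isLiftOn hcomplete hR' h1 h2 hy)
    hγ.continuousOn (y := y) (by simpa using hy)
  refine ⟨⟨fun t => Γ t, hΓ.continuousOn.comp_continuous continuous_subtype_val fun t => t.2⟩,
    hΓ0, ?_⟩
  ext t
  simpa using hΓ.lift t t.2

end DoublyWarpedProduct

theorem proposition2p4 {m : ℕ} {P : Type*} [TopologicalSpace P]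
    [ChartedSpace (EuclideanSpace ℝ (Fin m)) P] [IsManifold (𝓡 m) ∞ P]
    [T2Space P] [ConnectedSpace P] (S : DoublyWarpedProduct m P) :
    (∀ (M : Type*) [TopologicalSpace M] [ChartedSpace (EuclideanSpace ℝ (Fin m)) M]
        [IsManifold (𝓡 m) ∞ M] [T2Space M] [Nonempty M] [CompactSpace M] (ψ : M → S.Carrier),
        S.IsSpacelikeHypersurface ψ → CompactSpace P) ∧
    (∀ (Q : Type*) [TopologicalSpace Q] [CompactSpace Q] (p : Q → P), IsUniversalCovering p →
      ∀ (M : Type*) [TopologicalSpace M] [ChartedSpace (EuclideanSpace ℝ (Fin m)) M]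
        [IsManifold (𝓡 m) ∞ M] [T2Space M] [ConnectedSpace M] (ψ : M → S.Carrier),
        S.IsSpacelikeHypersurface ψ → S.IsCompleteHypersurface ψ →
        Bornology.IsBounded (Set.range fun x : M => S.ρ (ψ x).1) → CompactSpace M) := by
  refine ⟨?_, ?_⟩
  · intro M _ _ _ _ _ _ ψ hψ
    exact compactSpace_of_isLocalHomeomorph hψ.isLocalHomeomorph_snd
  · intro Q _ _ p hp M _ _ _ _ _ ψ hψ hcomplete hbdd
    exact hψ.compactSpace_of_complete hcomplete hbdd hp
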